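/- Let $0<\alpha<1$, $b>0$, $\lambda,u_0\in\mathbb R$. Let $B:[0,1]\to(0,\infty)$ satisfy $B(0)=B(1)=1$, and assume $B(\alpha)\neq\lambda(1-\alpha)$. Let $f\in H^1(0,b)\cap C[0,b]$ be real-valued. Write $E_\alpha(z)=\sum_{k\ge0} z^k/\Gamma(\alpha k+1)$, $(p*q)(t)=\int_0^t p(t-s)q(s)\,ds$, and for $u\in H^1(0,b)$ with weak derivative $u'$ $$({}^{ABC}D^\alpha u)(t)=\frac{B(\alpha)}{1-\alpha}\int_0^t E_\alpha\Big[-\frac{\alpha}{1-\alpha}(t-s)^\alpha\Big]u'(s)\,ds .$$ The initial value problem $$({}^{ABC}D^\alpha u)(t)=\lambda u(t)+f(t)\quad(0<t\le b),\qquad u(0)=u_0,$$ has a solution $u\in H^1(0,b)\cap C[0,b]$ if and only if $\lambda u_0+f(0)=0$. In that case the solution is unique, and for $t\in[0,b]$ it is given by $$u(t)=\frac{1}{B(\alpha)-\lambda(1-\alpha)}\Big(B(\alpha)\,u_0\,E_\alpha[\omega t^\alpha]+(1-\alpha)\big((g*f')(t)+f(0)\,g(t)\big)\Big),$$ where $\omega=\dfrac{\lambda\alpha}{B(\alpha)-\lambda(1-\alpha)}$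 and $g(t)=E_\alpha[\omega t^\alpha]+\dfrac{\alpha}{1-\alpha}\displaystyle\int_0^t\frac{(t-s)^{\alpha-1}}{\Gamma(\alpha)}E_\alpha[\omega s^\alpha]\,ds$. -/

import Mathlib

open MeasureTheory Set
open scoped ContDiff

noncomputable section

namespace ABCaputo

/-- The (real, one-parameter) Mittag-Leffler function `E_α(z) = ∑ z ^ k / Γ(α k + 1)`;
the series converges for every `z` when `0 < α`. -/
def mittagLeffler (α z : ℝ) : ℝ :=
  ∑' k : ℕ, z ^ k / Real.Gamma (α * k + 1)

/-- `v` is a weak derivative of `u` on the open interval `(a, b)`. -/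
def IsWeakDeriv (a b : ℝ) (u v : ℝ → ℝ) : Prop :=
  ∀ φ : ℝ → ℝ, ContDiff ℝ ∞ φ → HasCompactSupport φ → tsupport φ ⊆ Ioo a b →
    ∫ t in Ioo a b, u t * deriv φ t = -∫ t in Ioo a b, v t * φ t

/-- The Sobolev space `H¹(a, b)`: `u ∈ L²(a, b)` with a weak derivative in `L²(a, b)`. -/
def MemH1 (a b : ℝ) (u : ℝ → ℝ) : Prop :=
  MemLp u 2 (volume.restrict (Ioo a b)) ∧
    ∃ v : ℝ → ℝ, MemLp v 2 (volume.restrict (Ioo a b)) ∧ IsWeakDeriv a b u v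

open Classical in
/-- The weak derivative `u' ∈ L²(a, b)` of `u ∈ H¹(a, b)` (a representative of it: it is unique
up to a null set of `(a, b)`, and it is only used under integrals over parts of `(a, b)`);
by convention `0` if `u ∉ H¹(a, b)`. -/
def weakDeriv (a b : ℝ) (u : ℝ → ℝ) : ℝ → ℝ :=
  if h : MemH1 a b u then h.2.choose else 0

/-- The left Caputo fractional derivative of order `α` with Mittag-Leffler kernel, based at `a`,
of a function `u ∈ H¹(a, b)`, with normalization function `B`:
`B(α) / (1 - α) ∫_a^t E_α[-α / (1 - α) (t - s) ^ α] u'(s) ds`. -/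
def abcDeriv (B : ℝ → ℝ) (α a b : ℝ) (u : ℝ → ℝ) (t : ℝ) : ℝ :=
  B α / (1 - α) *
    ∫ s in a..t, mittagLeffler α (-(α / (1 - α)) * (t - s) ^ α) * weakDeriv a b u s

/-- The one-sided convolution `(p * q)(t) = ∫_0^t p(t - s) q(s) ds`. -/
def conv (p q : ℝ → ℝ) (t : ℝ) : ℝ :=
  ∫ s in (0 : ℝ)..t, p (t - s) * q s

/-- `u ∈ H¹(0, b) ∩ C[0, b]` solves `D^α u = lam u + f` on `(0, b]`, `u(0) = u₀`. -/
structure IsSolution (B : ℝ → ℝ) (α b lam u₀ : ℝ) (f u : ℝ → ℝ) : Prop where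
  memH1 : MemH1 0 b u
  continuousOn : ContinuousOn u (Icc 0 b)
  equation : ∀ t ∈ Ioc 0 b, abcDeriv B α 0 b u t = lam * u t + f t
  initial : u 0 = u₀

/-- `ω = λ α / (B(α) - λ (1 - α))`. -/
def omega (B : ℝ → ℝ) (α lam : ℝ) : ℝ :=
  lam * α / (B α - lam * (1 - α))

/-- `g(t) = E_α[ω t^α] + α / (1 - α) (t^(α-1) / Γ(α)) * E_α[ω t^α]`, `*` being convolution. -/
def gKernel (B : ℝ → ℝ) (α lam : ℝ) (t : ℝ) : ℝ :=
  mittagLeffler α (omega B α lam * t ^ α) +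
    α / (1 - α) *
      conv (fun s => s ^ (α - 1) / Real.Gamma α)
        (fun s => mittagLeffler α (omega B α lam * s ^ α)) t

/-- The right-hand side of the solution formula. -/
def solutionFormula (B : ℝ → ℝ) (α b lam u₀ : ℝ) (f : ℝ → ℝ) (t : ℝ) : ℝ :=
  1 / (B α - lam * (1 - α)) *
    (B α * u₀ * mittagLeffler α (omega B α lam * t ^ α) +
      (1 - α) * (conv (gKernel B α lam) (weakDeriv 0 b f) t + f 0 * gKernel B α lam t))

end ABCaputo

end

open MeasureTheory Set
open scoped ContDiff

noncomputable section

namespace ABCaputo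

/-! Write `v = u'`, `N = B α`, `μ = -α/(1-α)`, `D = N/(1-α) - λ`, and let `P_c`, `e_c` be `mlKernel`
with parameters `1`, `α`, whose Laplace transforms are `s^(α-1)/(s^α - c)` and `1/(s^α - c)`. The
fractional derivative of `u` is `N/(1-α) (P_μ * v)`, a continuous function vanishing at `0`, so the
equation forces `λ u₀ + f(0) = 0`.

Conversely, under this condition, inserting `u = u₀ + 1 * v` and `f = f(0) + 1 * f'` leaves the
first-kind Volterra equation `K * v = 1 * f'` with `K = N/(1-α) P_μ - λ`. The transform of `K` is
`(D/s)(s^α - ω)/(s^α - μ)`, since `D ω = -λ μ`; hence `K * (δ + (ω - μ) e_ω) = D`. Applying this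
resolvent gives `D v = f' + (ω - μ) e_ω * f'`, and one integration gives the stated formula.

No Laplace transform is used: the inversion rests on the resolvent identity `sub_mul_conv_mlKernel`,
obtained from the beta integral and from associativity of convolution. Absolutely continuous
representatives link `H¹` to primitives, and the bound `L¹ * L² ⊆ L²` puts the constructed solution
in `H¹`. -/

/-- The two-parameter Mittag-Leffler function `E_{α,β}(z) = ∑ z ^ k / Γ(α k + β)`. -/
def mittagLeffler₂ (α β z : ℝ) : ℝ :=
  ∑' k : ℕ, z ^ k / Real.Gamma (α * k + β)

/-- The kernel `t ^ (γ - 1) / Γ(γ)` of the Riemann-Liouville integral of order `γ`. -/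
def rlKernel (γ t : ℝ) : ℝ := t ^ (γ - 1) / Real.Gamma γ

/-- The function `t ^ (β - 1) E_{α,β}(c t ^ α)`. -/
def mlKernel (α β c t : ℝ) : ℝ := t ^ (β - 1) * mittagLeffler₂ α β (c * t ^ α)

/-! ### Mittag-Leffler series and their kernels -/

/-- Keep only the part of the Gamma integral over `(A, ∞)`, where `t ^ (x - 1) ≥ A ^ (x - 1)`. As
`A` is free, `Γ` outgrows every exponential. -/
theorem rpow_mul_exp_neg_le_Gamma {A x : ℝ} (hA : 0 < A) (hx : 1 ≤ x) :
    A ^ (x - 1) * Real.exp (-A) ≤ Real.Gamma x := by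
  have hx0 : 0 < x := by linarith
  rw [Real.Gamma_eq_integral hx0, ← integral_exp_neg_Ioi, ← integral_const_mul]
  have hint := Real.GammaIntegral_convergent hx0
  calc ∫ t in Ioi A, A ^ (x - 1) * Real.exp (-t)
      ≤ ∫ t in Ioi A, Real.exp (-t) * t ^ (x - 1) := by
        refine setIntegral_mono_on ((integrableOn_exp_neg_Ioi A).const_mul _)
          (hint.mono_set (Ioi_subset_Ioi hA.le)) measurableSet_Ioi fun t ht => ?_
        rw [mul_comm]
        gcongr
        exact (mem_Ioi.1 ht).le
    _ ≤ _ := by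
        refine setIntegral_mono_set hint ?_ (Ioi_subset_Ioi hA.le).eventuallyLE
        filter_upwards [ae_restrict_mem measurableSet_Ioi] with t ht
        have : 0 < t := ht
        simp only [Pi.zero_apply]
        positivity

theorem summable_abs_pow_div_Gamma {α β : ℝ} (hα : 0 < α) (hβ : 0 < β) (z : ℝ) :
    Summable fun k : ℕ => |z| ^ k / Real.Gamma (α * k + β) := by
  -- With this `A`, each factor `|z| / A ^ α` is at most `1/2`, so the series is dominated by a
  -- geometric one.
  obtain ⟨A, hA, hAz⟩ : ∃ A : ℝ, 0 < A ∧ A ^ α = 2 * (|z| + 1) := by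
    refine ⟨(2 * (|z| + 1)) ^ (1 / α), by positivity, ?_⟩
    rw [← Real.rpow_mul (by positivity), one_div_mul_cancel hα.ne', Real.rpow_one]
  have hgeo : Summable fun k : ℕ => Real.exp A * A ^ (1 - β) * (1 / 2 : ℝ) ^ k :=
    (summable_geometric_of_lt_one (by norm_num) (by norm_num)).mul_left _
  refine Summable.of_norm_bounded_eventually_nat hgeo ?_
  filter_upwards [Filter.eventually_ge_atTop ⌈1 / α⌉₊] with k hk
  have hk1 : 1 ≤ α * k := by
    have := (Nat.ceil_le.1 hk)
    rw [div_le_iff₀ hα] at this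
    linarith
  have hG := rpow_mul_exp_neg_le_Gamma (x := α * k + β) hA (by linarith)
  have hGpos : 0 < Real.Gamma (α * k + β) := Real.Gamma_pos_of_pos (by positivity)
  rw [Real.norm_of_nonneg (by positivity), div_le_iff₀ hGpos]
  have key : |z| ^ k = |z| ^ k * ((A ^ α) ^ k)⁻¹ * A ^ (1 - β) * Real.exp A *
      (A ^ (α * k + β - 1) * Real.exp (-A)) := by
    have h1 : A ^ (α * k + β - 1) = (A ^ α) ^ k * (A ^ (1 - β))⁻¹ := by
      rw [← Real.rpow_neg hA.le, ← Real.rpow_natCast, ← Real.rpow_mul hA.le,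
        ← Real.rpow_add hA]
      ring_nf
    rw [h1, Real.exp_neg]
    have := (Real.rpow_pos_of_pos hA (1 - β)).ne'
    have := (Real.rpow_pos_of_pos hA α).ne'
    field_simp
  have hz : |z| ^ k * ((A ^ α) ^ k)⁻¹ ≤ (1 / 2 : ℝ) ^ k := by
    rw [← inv_pow, ← mul_pow, hAz]
    gcongr
    rw [← div_eq_mul_inv, div_le_div_iff₀ (by positivity) (by norm_num)]
    linarith
  rw [key]
  calc _ ≤ (1 / 2 : ℝ) ^ k * A ^ (1 - β) * Real.exp A * Real.Gamma (α * k + β) := by gcongr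
    _ = _ := by ring

theorem summable_pow_div_Gamma {α β : ℝ} (hα : 0 < α) (hβ : 0 < β) (z : ℝ) :
    Summable fun k : ℕ => z ^ k / Real.Gamma (α * k + β) := by
  refine Summable.of_norm_bounded (summable_abs_pow_div_Gamma hα hβ z) fun k => ?_
  have hGpos : 0 < Real.Gamma (α * k + β) := Real.Gamma_pos_of_pos (by positivity)
  simp [abs_of_pos hGpos]

theorem continuous_mittagLeffler₂ {α β : ℝ} (hα : 0 < α) (hβ : 0 < β) :
    Continuous (mittagLeffler₂ α β) := by
  rw [continuous_iff_continuousAt]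
  intro z
  have : ContinuousOn (mittagLeffler₂ α β) (Icc (-(|z| + 1)) (|z| + 1)) := by
    refine continuousOn_tsum (u := fun k : ℕ => |(|z| + 1)| ^ k / Real.Gamma (α * k + β))
      (fun k => by fun_prop) (summable_abs_pow_div_Gamma hα hβ _) fun k x hx => ?_
    have hGpos : 0 < Real.Gamma (α * k + β) := Real.Gamma_pos_of_pos (by positivity)
    rw [norm_div, norm_pow, Real.norm_eq_abs, Real.norm_eq_abs, abs_of_pos hGpos]
    have := (abs_le.2 hx).trans (le_abs_self _)
    gcongr
  refine this.continuousAt (Icc_mem_nhds ?_ ?_)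
  · linarith [neg_abs_le z]
  · linarith [le_abs_self z]

/-- Splitting off the term `k = 0` shifts the second parameter by `α`. -/
theorem mittagLeffler₂_eq_add {α β : ℝ} (hα : 0 < α) (hβ : 0 < β) (z : ℝ) :
    mittagLeffler₂ α β z = 1 / Real.Gamma β + z * mittagLeffler₂ α (β + α) z := by
  rw [mittagLeffler₂, (summable_pow_div_Gamma hα hβ z).tsum_eq_zero_add, mittagLeffler₂,
    ← tsum_mul_left]
  simp only [pow_zero, Nat.cast_zero, mul_zero, zero_add]
  congr 1
  refine tsum_congr fun k => ?_
  rw [show α * ((k + 1 : ℕ) : ℝ) + β = α * k + (β + α) by push_cast; ring, pow_succ]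
  ring

theorem continuous_mlKernel {α β : ℝ} (hα : 0 < α) (hβ : 1 ≤ β) (c : ℝ) :
    Continuous (mlKernel α β c) := by
  unfold mlKernel
  exact (Real.continuous_rpow_const (by linarith)).mul
    ((continuous_mittagLeffler₂ hα (by linarith)).comp
      (continuous_const.mul (Real.continuous_rpow_const hα.le)))

theorem intervalIntegrable_mlKernel {α β : ℝ} (hα : 0 < α) (hβ : 0 < β) (c a b : ℝ) :
    IntervalIntegrable (mlKernel α β c) volume a b := by
  unfold mlKernel
  exact (intervalIntegral.intervalIntegrable_rpow' (by linarith)).mul_continuousOn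
    ((continuous_mittagLeffler₂ hα hβ).comp
      (continuous_const.mul (Real.continuous_rpow_const hα.le))).continuousOn

theorem mlKernel_one (α c t : ℝ) : mlKernel α 1 c t = mittagLeffler α (c * t ^ α) := by
  simp [mlKernel, mittagLeffler, mittagLeffler₂]

theorem mlKernel_eq_add {α β : ℝ} (hα : 0 < α) (hβ : 0 < β) (c : ℝ) {t : ℝ} (ht : 0 < t) :
    mlKernel α β c t = rlKernel β t + c * mlKernel α (β + α) c t := by
  rw [mlKernel, mittagLeffler₂_eq_add hα hβ, rlKernel, mlKernel,
    show β + α - 1 = β - 1 + α by ring, Real.rpow_add ht]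
  ring

theorem mlKernel_one_eq_add {α : ℝ} (hα : 0 < α) (c : ℝ) {t : ℝ} (ht : 0 ≤ t) :
    mlKernel α 1 c t = 1 + c * mlKernel α (1 + α) c t := by
  rcases ht.eq_or_lt with rfl | ht
  · rw [mlKernel, mittagLeffler₂_eq_add hα one_pos, mlKernel]
    simp [hα.ne', Real.zero_rpow]
  · rw [mlKernel_eq_add hα one_pos c ht]
    simp [rlKernel]

theorem hasSum_mlKernel {α β : ℝ} (hα : 0 < α) (hβ : 0 < β) (c : ℝ) {t : ℝ} (ht : 0 < t) :
    HasSum (fun k : ℕ => c ^ k * rlKernel (α * k + β) t) (mlKernel α β c t) := by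
  have h := ((summable_pow_div_Gamma hα hβ (c * t ^ α)).hasSum).mul_left (t ^ (β - 1))
  have heq : (fun k : ℕ => c ^ k * rlKernel (α * k + β) t) =
      fun k : ℕ => t ^ (β - 1) * ((c * t ^ α) ^ k / Real.Gamma (α * k + β)) := by
    funext k
    rw [rlKernel, show α * k + β - 1 = (β - 1) + α * k by ring, Real.rpow_add ht,
      Real.rpow_mul ht.le, Real.rpow_natCast, mul_pow]
    ring
  rw [heq]
  exact h

/-! ### Convolution of Riemann-Liouville and Mittag-Leffler kernels -/

theorem rlKernel_nonneg {γ t : ℝ} (hγ : 0 < γ) (ht : 0 ≤ t) : 0 ≤ rlKernel γ t :=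
  div_nonneg (Real.rpow_nonneg ht _) (Real.Gamma_pos_of_pos hγ).le

theorem intervalIntegrable_rlKernel {γ : ℝ} (hγ : 0 < γ) (a b : ℝ) :
    IntervalIntegrable (rlKernel γ) volume a b :=
  (intervalIntegral.intervalIntegrable_rpow' (by linarith)).div_const _

theorem conv_comm (p q : ℝ → ℝ) (t : ℝ) : conv p q t = conv q p t := by
  have := intervalIntegral.integral_comp_sub_left (a := 0) (b := t)
    (fun s => p s * q (t - s)) t
  simp only [sub_self, sub_zero, sub_sub_cancel] at this
  rw [conv, this, conv]
  exact intervalIntegral.integral_congr fun s _ => mul_comm _ _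

/-- The semigroup law of fractional integration, which is Euler's beta integral scaled to `[0, t]`.
-/
theorem conv_rlKernel {γ β : ℝ} (hγ : 0 < γ) (hβ : 0 < β) {t : ℝ} (ht : 0 < t) :
    conv (rlKernel γ) (rlKernel β) t = rlKernel (γ + β) t := by
  have h := Complex.betaIntegral_scaled (β : ℂ) (γ : ℂ) ht
  rw [Complex.betaIntegral_eq_Gamma_mul_div _ _ (by simpa) (by simpa)] at h
  have h2 : ∫ x in (0 : ℝ)..t, x ^ (β - 1) * (t - x) ^ (γ - 1) =
      t ^ (β + γ - 1) * (Real.Gamma β * Real.Gamma γ / Real.Gamma (β + γ)) := by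
    apply Complex.ofReal_injective
    rw [← intervalIntegral.integral_ofReal]
    convert h using 1
    · refine intervalIntegral.integral_congr fun x hx => ?_
      rw [uIcc_of_le ht.le] at hx
      rw [Complex.ofReal_mul, Complex.ofReal_cpow hx.1, Complex.ofReal_cpow (by linarith [hx.2])]
      push_cast
      rfl
    · rw [Complex.ofReal_mul, Complex.ofReal_cpow ht.le, Complex.ofReal_div, Complex.ofReal_mul,
        ← Complex.Gamma_ofReal, ← Complex.Gamma_ofReal, ← Complex.Gamma_ofReal]
      push_cast
      rfl
  have h3 : conv (rlKernel γ) (rlKernel β) t =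
      (∫ x in (0 : ℝ)..t, x ^ (β - 1) * (t - x) ^ (γ - 1)) *
        (1 / (Real.Gamma β * Real.Gamma γ)) := by
    rw [conv, ← intervalIntegral.integral_mul_const]
    refine intervalIntegral.integral_congr fun x _ => ?_
    simp only [rlKernel]
    field_simp
  have := (Real.Gamma_pos_of_pos hγ).ne'
  have := (Real.Gamma_pos_of_pos hβ).ne'
  rw [h3, h2, rlKernel, add_comm γ β]
  field_simp

theorem intervalIntegrable_conv_rlKernel {γ β : ℝ} (hγ : 0 < γ) (hβ : 0 < β) {t : ℝ}
    (ht : 0 < t) :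
    IntervalIntegrable (fun s => rlKernel γ (t - s) * rlKernel β s) volume 0 t := by
  -- A non-integrable integrand would have integral `0` by convention, but the beta integral gives a
  -- positive value.
  by_contra hne
  have h := conv_rlKernel hγ hβ ht
  rw [conv, intervalIntegral.integral_undef hne] at h
  have : 0 < rlKernel (γ + β) t :=
    div_pos (Real.rpow_pos_of_pos ht _) (Real.Gamma_pos_of_pos (by linarith))
  linarith

/-- Termwise use of the semigroup law. The kernels are nonnegative, so the integrals of the norms
form the same series with `|c|` in place of `c`, which converges. -/
theorem conv_rlKernel_mlKernel {α β γ : ℝ} (hα : 0 < α) (hβ : 0 < β) (hγ : 0 < γ) (c : ℝ)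
    {t : ℝ} (ht : 0 < t) :
    conv (rlKernel γ) (mlKernel α β c) t = mlKernel α (β + γ) c t := by
  have hpos : ∀ k : ℕ, 0 < α * k + β := fun k => by positivity
  have hII := fun k : ℕ => intervalIntegrable_conv_rlKernel hγ (hpos k) ht
  have hval : ∀ (d : ℝ) (k : ℕ),
      ∫ s in Ioc 0 t, d * (rlKernel γ (t - s) * rlKernel (α * k + β) s) =
        d * rlKernel (α * k + (β + γ)) t := by
    intro d k
    rw [integral_const_mul, ← intervalIntegral.integral_of_le ht.le,
      show α * k + (β + γ) = γ + (α * k + β) by ring, ← conv_rlKernel hγ (hpos k) ht, conv]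
  have hsum := hasSum_integral_of_summable_integral_norm (μ := volume.restrict (Ioc 0 t))
    (F := fun (k : ℕ) s => c ^ k * (rlKernel γ (t - s) * rlKernel (α * k + β) s))
    (fun k => ((intervalIntegrable_iff_integrableOn_Ioc_of_le ht.le).1 (hII k)).const_mul _) (by
      refine ((hasSum_mlKernel hα (add_pos hβ hγ) |c| ht).summable).congr fun k => ?_
      rw [← hval]
      refine setIntegral_congr_fun measurableSet_Ioc fun s hs => ?_
      have h1 := rlKernel_nonneg hγ (sub_nonneg.2 hs.2)
      have h2 := rlKernel_nonneg (hpos k) hs.1.le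
      simp [abs_of_nonneg h1, abs_of_nonneg h2])
  simp_rw [hval] at hsum
  rw [(hasSum_mlKernel hα (add_pos hβ hγ) c ht).unique hsum, conv,
    intervalIntegral.integral_of_le ht.le]
  refine setIntegral_congr_fun measurableSet_Ioc fun s hs => ?_
  have := ((hasSum_mlKernel hα hβ c hs.1).mul_left (rlKernel γ (t - s))).tsum_eq
  rw [← this]
  exact tsum_congr fun k => by ring

/-! ### One-sided convolution as convolution on the line -/

/-- The truncation of `p` to `(0, T]`. -/
def trunc (T : ℝ) (p : ℝ → ℝ) : ℝ → ℝ := (Ioc 0 T).indicator p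

theorem trunc_of_mem {T s : ℝ} (hs : s ∈ Ioc 0 T) (p : ℝ → ℝ) : trunc T p s = p s :=
  indicator_of_mem hs p

theorem trunc_of_notMem {T s : ℝ} (hs : s ∉ Ioc 0 T) (p : ℝ → ℝ) : trunc T p s = 0 :=
  indicator_of_notMem hs p

theorem trunc_mul_trunc_eq_indicator {T t : ℝ} (ht : t ≤ T) (p q : ℝ → ℝ) (s : ℝ) :
    trunc T p s * trunc T q (t - s) = (Ioo 0 t).indicator (fun s => q (t - s) * p s) s := by
  by_cases hs : s ∈ Ioo 0 t
  · rw [indicator_of_mem hs, trunc_of_mem ⟨hs.1, hs.2.le.trans ht⟩,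
      trunc_of_mem ⟨by linarith [hs.2], by linarith [hs.1]⟩, mul_comm]
  · rw [indicator_of_notMem hs]
    rcases le_or_gt s 0 with h | h
    · rw [trunc_of_notMem (fun h' => h.not_gt h'.1), zero_mul]
    · have : t ≤ s := not_lt.1 fun h' => hs ⟨h, h'⟩
      rw [mul_comm, trunc_of_notMem (fun h' => by linarith [h'.1]), zero_mul]

theorem conv_eq_convolution {T t : ℝ} (ht : t ∈ Ioc 0 T) (p q : ℝ → ℝ) :
    conv p q t = convolution (trunc T p) (trunc T q) (ContinuousLinearMap.mul ℝ ℝ) volume t := by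
  rw [conv_comm, conv, intervalIntegral.integral_of_le ht.1.le, integral_Ioc_eq_integral_Ioo,
    ← integral_indicator measurableSet_Ioo, convolution]
  exact integral_congr_ae (.of_forall fun s => (trunc_mul_trunc_eq_indicator ht.2 p q s).symm)

theorem integrable_trunc {T : ℝ} {p : ℝ → ℝ} (hp : IntegrableOn p (Ioc 0 T)) :
    Integrable (trunc T p) :=
  (integrable_indicator_iff measurableSet_Ioc).2 hp

theorem conv_zero_right_endpoint (p q : ℝ → ℝ) : conv p q 0 = 0 := by simp [conv]

theorem conv_congr {T t : ℝ} (ht : t ∈ Icc 0 T) {p p' q q' : ℝ → ℝ}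
    (hp : ∀ s ∈ Ioc 0 T, p s = p' s) (hq : ∀ᵐ s, s ∈ Ioo 0 T → q s = q' s) :
    conv p q t = conv p' q' t := by
  rw [conv, conv, intervalIntegral.integral_of_le ht.1, intervalIntegral.integral_of_le ht.1,
    integral_Ioc_eq_integral_Ioo, integral_Ioc_eq_integral_Ioo]
  refine setIntegral_congr_ae measurableSet_Ioo ?_
  filter_upwards [hq] with s hs hst
  rw [hs ⟨hst.1, hst.2.trans_le ht.2⟩, hp (t - s) ⟨by linarith [hst.2], by linarith [hst.1, ht.2]⟩]

theorem integrableOn_conv {T : ℝ} {p q : ℝ → ℝ} (hp : IntegrableOn p (Ioc 0 T))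
    (hq : IntegrableOn q (Ioc 0 T)) : IntegrableOn (conv p q) (Ioc 0 T) :=
  (((integrable_trunc hp).integrable_convolution (ContinuousLinearMap.mul ℝ ℝ)
    (integrable_trunc hq)).integrableOn).congr_fun
      (fun _ ht => (conv_eq_convolution ht p q).symm) measurableSet_Ioc

theorem intervalIntegrable_conv_integrand {T t M : ℝ} {p q : ℝ → ℝ}
    (hp : IntegrableOn p (Ioc 0 T)) (hM : ∀ s ∈ Ioc 0 T, |p s| ≤ M)
    (hq : IntegrableOn q (Ioc 0 T)) (ht : t ∈ Icc 0 T) :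
    IntervalIntegrable (fun s => p (t - s) * q s) volume 0 t := by
  rw [intervalIntegrable_iff_integrableOn_Ioo_of_le ht.1, ← integrable_indicator_iff
    measurableSet_Ioo]
  rw [← funext (trunc_mul_trunc_eq_indicator ht.2 q p)]
  have hp' : AEStronglyMeasurable (fun s => trunc T p (t - s)) volume :=
    ((integrable_trunc hp).comp_sub_left t).aestronglyMeasurable
  refine (integrable_trunc hq).mul_bdd (c := max M 0) hp' (.of_forall fun s => ?_)
  rw [trunc, indicator]
  split_ifs with h
  · exact (hM _ h).trans (le_max_left _ _)
  · simp

/-- Boundedness of `p` gives the identity at every `t`, not merely almost everywhere: it makes the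
triple integral converge absolutely at the given point. -/
theorem conv_assoc {T t M : ℝ} {p q r : ℝ → ℝ}
    (hp : IntegrableOn p (Ioc 0 T)) (hM : ∀ s ∈ Ioc 0 T, |p s| ≤ M)
    (hq : IntegrableOn q (Ioc 0 T)) (hr : IntegrableOn r (Ioc 0 T)) (ht : t ∈ Icc 0 T) :
    conv (conv p q) r t = conv p (conv q r) t := by
  rcases ht.1.eq_or_lt with rfl | ht0
  · rw [conv_zero_right_endpoint, conv_zero_right_endpoint]
  have ht' : t ∈ Ioc 0 T := ⟨ht0, ht.2⟩
  have hp1 := integrable_trunc hp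
  have hq1 := integrable_trunc hq
  have hr1 := integrable_trunc hr
  have key := convolution_assoc (ContinuousLinearMap.mul ℝ ℝ) (ContinuousLinearMap.mul ℝ ℝ)
    (ContinuousLinearMap.mul ℝ ℝ) (ContinuousLinearMap.mul ℝ ℝ) (f := trunc T p) (g := trunc T q)
    (k := trunc T r) (μ := volume) (ν := volume) (x₀ := t) (fun x y z => mul_assoc x y z)
    hp1.aestronglyMeasurable hq1.aestronglyMeasurable hr1.aestronglyMeasurable
    (hp1.ae_convolution_exists _ hq1) (hq1.norm.ae_convolution_exists _ hr1.norm) (by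
      have h := (hq1.norm.integrable_convolution (ContinuousLinearMap.mul ℝ ℝ)
        hr1.norm).comp_sub_left t
      refine h.bdd_mul (c := max M 0) hp1.norm.aestronglyMeasurable (.of_forall fun s => ?_)
      rw [trunc, indicator]
      split_ifs with h
      · simpa using Or.inl (hM _ h)
      · simp)
  -- This fails beyond `T`, where the convolution of truncations need not vanish; there the
  -- remaining truncated factor is zero.
  have h1 : ∀ p q : ℝ → ℝ, ∀ s ≤ T,
      convolution (trunc T p) (trunc T q) (ContinuousLinearMap.mul ℝ ℝ) volume s =
      trunc T (conv p q) s := by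
    intro p q s hs
    by_cases hs0 : 0 < s
    · rw [← conv_eq_convolution ⟨hs0, hs⟩, trunc_of_mem ⟨hs0, hs⟩]
    · rw [trunc_of_notMem (fun h => hs0 h.1), convolution]
      simp only [ContinuousLinearMap.mul_apply', trunc_mul_trunc_eq_indicator hs,
        Ioo_eq_empty hs0, indicator_empty, integral_zero]
  rw [conv_eq_convolution ht', conv_eq_convolution ht']
  convert key using 1
  · refine integral_congr_ae (.of_forall fun s => ?_)
    simp only [ContinuousLinearMap.mul_apply']
    rcases le_or_gt s T with hs | hs
    · rw [h1 _ _ _ hs]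
    · have : trunc T r (t - s) = 0 := trunc_of_notMem (fun h => by linarith [h.1, ht.2]) _
      rw [this, mul_zero, mul_zero]
  · refine integral_congr_ae (.of_forall fun s => ?_)
    simp only [ContinuousLinearMap.mul_apply']
    rcases le_or_gt s 0 with hs | hs
    · have : trunc T p s = 0 := trunc_of_notMem (fun h => by linarith [h.1]) _
      rw [this, zero_mul, zero_mul]
    · rw [h1 _ _ _ (by linarith [ht.2])]

/-! ### Young's inequality for `L¹ * L²` -/

open scoped ENNReal in
theorem lintegral_lintegral_mul_sub_sq_le {F G : ℝ → ℝ≥0∞} (hF : Measurable F)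
    (hG : Measurable G) :
    ∫⁻ x, (∫⁻ s, F s * G (x - s)) ^ (2 : ℝ) ≤
      (∫⁻ s, F s) * ((∫⁻ s, F s) * ∫⁻ s, G s ^ (2 : ℝ)) := by
  have hpt : ∀ x, (∫⁻ s, F s * G (x - s)) ^ (2 : ℝ) ≤
      (∫⁻ s, F s) * ∫⁻ s, F s * G (x - s) ^ (2 : ℝ) := by
    -- Cauchy-Schwarz for `F G = F^(1/2) (F G²)^(1/2)`; Tonelli and translation invariance then
    -- finish the estimate.
    intro x
    have h := ENNReal.lintegral_mul_norm_pow_le (μ := volume) (f := F)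
      (g := fun s => F s * G (x - s) ^ (2 : ℝ)) hF.aemeasurable (by fun_prop)
      (p := 1 / 2) (q := 1 / 2) (by norm_num) (by norm_num) (by norm_num)
    have heq : ∀ s, F s ^ (1 / 2 : ℝ) * (F s * G (x - s) ^ (2 : ℝ)) ^ (1 / 2 : ℝ) =
        F s * G (x - s) := by
      intro s
      rw [ENNReal.mul_rpow_of_nonneg _ _ (by norm_num), ← ENNReal.rpow_mul, ← mul_assoc,
        ← ENNReal.rpow_add_of_nonneg _ _ (by norm_num) (by norm_num)]
      norm_num
    simp_rw [heq] at h
    refine (ENNReal.rpow_le_rpow h (by norm_num : (0 : ℝ) ≤ 2)).trans_eq ?_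
    rw [ENNReal.mul_rpow_of_nonneg _ _ (by norm_num), ← ENNReal.rpow_mul, ← ENNReal.rpow_mul]
    norm_num
  refine (lintegral_mono hpt).trans_eq ?_
  rw [lintegral_const_mul _ (by fun_prop), lintegral_lintegral_swap (by fun_prop)]
  congr 1
  rw [← lintegral_mul_const _ hF]
  refine lintegral_congr fun s => ?_
  rw [lintegral_const_mul _ (by fun_prop), lintegral_sub_right_eq_self (fun x => G x ^ (2 : ℝ)) s]

theorem memLp_two_convolution {f g : ℝ → ℝ} (hf : Integrable f) (hg : Integrable g)
    (hg2 : MemLp g 2) :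
    MemLp (convolution f g (ContinuousLinearMap.mul ℝ ℝ) volume) 2 := by
  refine ⟨(hf.integrable_convolution _ hg).aestronglyMeasurable, ?_⟩
  obtain ⟨f', hf'm, hff'⟩ := hf.aestronglyMeasurable
  obtain ⟨g', hg'm, hgg'⟩ := hg.aestronglyMeasurable
  rw [convolution_congr _ hff' hgg', eLpNorm_lt_top_iff_lintegral_rpow_enorm_lt_top (by norm_num)
    (by norm_num)]
  have hf1 : ∫⁻ s, ‖f' s‖ₑ < ⊤ := (hf.congr hff').hasFiniteIntegral
  have hg1 : ∫⁻ s, ‖g' s‖ₑ ^ (2 : ℝ) < ⊤ := by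
    simpa using (eLpNorm_lt_top_iff_lintegral_rpow_enorm_lt_top (by norm_num)
      (by norm_num)).1 ((memLp_congr_ae hgg').1 hg2).2
  refine lt_of_le_of_lt ?_ (ENNReal.mul_lt_top hf1 (ENNReal.mul_lt_top hf1 hg1))
  refine le_trans (lintegral_mono fun x => ?_)
    (lintegral_lintegral_mul_sub_sq_le hf'm.enorm hg'm.enorm)
  simp only [ENNReal.toReal_ofNat]
  gcongr
  refine (enorm_integral_le_lintegral_enorm _).trans_eq (lintegral_congr fun s => ?_)
  simp

theorem memLp_two_conv {T : ℝ} {p q : ℝ → ℝ} (hp : IntegrableOn p (Ioc 0 T))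
    (hq : MemLp q 2 (volume.restrict (Ioo 0 T))) :
    MemLp (conv p q) 2 (volume.restrict (Ioo 0 T)) := by
  rw [← restrict_Ioo_eq_restrict_Ioc.symm] at hq ⊢
  have hq1 : IntegrableOn q (Ioc 0 T) := hq.integrable (by norm_num)
  have hq2 : MemLp (trunc T q) 2 := (memLp_indicator_iff_restrict measurableSet_Ioc).2 hq
  have h := (memLp_two_convolution (integrable_trunc hp) (integrable_trunc hq1) hq2).restrict
    (Ioc 0 T)
  refine (memLp_congr_ae ?_).1 h
  filter_upwards [ae_restrict_mem measurableSet_Ioc] with t ht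
  exact (conv_eq_convolution ht p q).symm

/-! ### Weak derivatives and primitives on an interval -/

theorem setIntegral_Ioo_eq_integral_of_tsupport {a b : ℝ} {φ : ℝ → ℝ} (h : tsupport φ ⊆ Ioo a b)
    (w : ℝ → ℝ) : ∫ t in Ioo a b, w t * φ t = ∫ t, φ t * w t := by
  rw [setIntegral_eq_integral_of_forall_compl_eq_zero]
  · exact integral_congr_ae (.of_forall fun t => mul_comm _ _)
  · intro t ht
    rw [image_eq_zero_of_notMem_tsupport (fun h' => ht (h h')), mul_zero]

/-- The fundamental lemma of the calculus of variations on an interval. -/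
theorem ae_eq_zero_of_forall_setIntegral_mul_eq_zero {a b : ℝ} {w : ℝ → ℝ}
    (hw : IntegrableOn w (Ioo a b))
    (h : ∀ φ : ℝ → ℝ, ContDiff ℝ ∞ φ → HasCompactSupport φ → tsupport φ ⊆ Ioo a b →
      ∫ t in Ioo a b, w t * φ t = 0) :
    ∀ᵐ t, t ∈ Ioo a b → w t = 0 := by
  refine isOpen_Ioo.ae_eq_zero_of_integral_contDiff_smul_eq_zero hw.locallyIntegrableOn
    fun φ h1 h2 h3 => ?_
  rw [← h φ h1 h2 h3, setIntegral_Ioo_eq_integral_of_tsupport h3]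
  rfl

theorem integrableOn_mul_of_continuous {a b : ℝ} {w φ : ℝ → ℝ} (hw : IntegrableOn w (Ioo a b))
    (hφ : Continuous φ) (hc : HasCompactSupport φ) :
    IntegrableOn (fun t => w t * φ t) (Ioo a b) := by
  obtain ⟨C, hC⟩ := hc.exists_bound_of_continuous hφ
  exact hw.mul_bdd (c := C) hφ.aestronglyMeasurable (.of_forall hC)

/-- A smooth function of integral zero, compactly supported in an interval, is the derivative of
such a function. -/
theorem exists_deriv_eq_of_integral_eq_zero {a b : ℝ} {χ : ℝ → ℝ} (hχ : ContDiff ℝ ∞ χ)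
    (hc : HasCompactSupport χ) (hs : tsupport χ ⊆ Ioo a b) (h0 : ∫ t, χ t = 0) :
    ∃ ψ : ℝ → ℝ, ContDiff ℝ ∞ ψ ∧ HasCompactSupport ψ ∧ tsupport ψ ⊆ Ioo a b ∧
      deriv ψ = χ := by
  rcases (tsupport χ).eq_empty_or_nonempty with he | hne
  · have : χ = 0 := tsupport_eq_empty_iff.1 he
    subst this
    exact ⟨0, hχ, hc, hs, by ext; simp⟩
  obtain ⟨c, hc1, hc2⟩ := hc.isCompact.exists_isLeast hne
  obtain ⟨d, hd1, hd2⟩ := hc.isCompact.exists_isGreatest hne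
  have hzero : ∀ t, t ∉ Icc c d → χ t = 0 := fun t ht =>
    image_eq_zero_of_notMem_tsupport fun h => ht ⟨hc2 h, hd2 h⟩
  have hderiv : ∀ x, HasDerivAt (fun x => ∫ t in a..x, χ t) (χ x) x := fun x =>
    (hχ.continuous.integral_hasStrictDerivAt a x).hasDerivAt
  have hderiv' : deriv (fun x => ∫ t in a..x, χ t) = χ := funext fun x => (hderiv x).deriv
  have hsupp : Function.support (fun x => ∫ t in a..x, χ t) ⊆ Icc c d := by
    intro x hx
    by_contra hxn
    apply hx
    simp only
    rcases not_and_or.1 hxn with h | h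
    · have hxc := not_le.1 h
      rw [intervalIntegral.integral_congr (g := fun _ => 0), intervalIntegral.integral_zero]
      intro t ht
      refine hzero t fun h' => ?_
      have := ht.2.trans_lt (max_lt (hs hc1).1 hxc)
      linarith [h'.1]
    -- To the right of the support the primitive equals the total integral, which is zero.
    · have hxd := not_le.1 h
      rw [intervalIntegral.integral_eq_integral_of_support_subset, h0]
      intro t ht
      by_contra hn
      exact ht (hzero t fun h' => hn ⟨(hs hc1).1.trans_le h'.1, h'.2.trans hxd.le⟩)
  have htsupp := closure_minimal hsupp isClosed_Icc
  refine ⟨fun x => ∫ t in a..x, χ t, ?_, ?_, ?_, hderiv'⟩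
  · rw [contDiff_infty_iff_deriv, hderiv']
    exact ⟨fun x => (hderiv x).differentiableAt, hχ⟩
  · exact isCompact_Icc.of_isClosed_subset (isClosed_tsupport _) htsupp
  · exact htsupp.trans fun t ht => ⟨(hs hc1).1.trans_le ht.1, ht.2.trans_lt (hs hd1).2⟩

/-- The lemma of du Bois-Reymond. -/
theorem ae_eq_const_of_forall_setIntegral_mul_deriv_eq_zero {a b : ℝ} (hab : a < b) {w : ℝ → ℝ}
    (hw : IntegrableOn w (Ioo a b))
    (h : ∀ φ : ℝ → ℝ, ContDiff ℝ ∞ φ → HasCompactSupport φ → tsupport φ ⊆ Ioo a b →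
      ∫ t in Ioo a b, w t * deriv φ t = 0) :
    ∃ C, ∀ᵐ t, t ∈ Ioo a b → w t = C := by
  let B : ContDiffBump ((a + b) / 2) := ⟨(b - a) / 8, (b - a) / 4, by linarith, by linarith⟩
  set η : ℝ → ℝ := B.normed volume with hη
  have hη1 : ContDiff ℝ ∞ η := B.contDiff_normed (μ := volume)
  have hη2 : HasCompactSupport η := B.hasCompactSupport_normed (μ := volume)
  have hη3 : tsupport η ⊆ Ioo a b := by
    rw [hη, B.tsupport_normed_eq, Real.closedBall_eq_Icc]
    have : B.rOut = (b - a) / 4 := rfl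
    rw [this]
    intro t ht
    constructor <;> linarith [ht.1, ht.2]
  have hη4 : ∫ t, η t = 1 := B.integral_normed (μ := volume)
  refine ⟨∫ t in Ioo a b, w t * η t, ?_⟩
  set C := ∫ t in Ioo a b, w t * η t with hC
  have hconst : IntegrableOn (fun _ : ℝ => C) (Ioo a b) := integrableOn_const (by simp)
  have := ae_eq_zero_of_forall_setIntegral_mul_eq_zero (w := fun t => w t - C)
    (hw.sub hconst) ?_
  · filter_upwards [this] with t ht hmem
    exact sub_eq_zero.1 (ht hmem)
  intro φ h1 h2 h3
  set m := ∫ t, φ t with hm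
  have hiφ : Integrable φ := h1.continuous.integrable_of_hasCompactSupport h2
  have hiη : Integrable η := hη1.continuous.integrable_of_hasCompactSupport hη2
  -- Subtracting `m η`, where `η` has mass one, makes the integral vanish, so the difference is an
  -- admissible derivative.
  obtain ⟨ψ, p1, p2, p3, p4⟩ := exists_deriv_eq_of_integral_eq_zero (a := a) (b := b)
    (χ := φ - fun t => m * η t)
    (h1.sub (contDiff_const.mul hη1)) (h2.sub hη2.mul_left)
    ((tsupport_sub _ _).trans (union_subset h3 ((tsupport_mul_subset_right).trans hη3))) (by
      simp only [Pi.sub_apply]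
      rw [integral_sub hiφ (hiη.const_mul m), integral_const_mul, hη4, mul_one, sub_self])
  have hz := h ψ p1 p2 p3
  have e1 := integrableOn_mul_of_continuous hw h1.continuous h2
  have e2 := integrableOn_mul_of_continuous hw hη1.continuous hη2
  have e3 := integrableOn_mul_of_continuous hconst h1.continuous h2
  have hwφ : ∫ t in Ioo a b, w t * φ t = m * C := by
    rw [p4] at hz
    simp only [Pi.sub_apply] at hz
    have : ∀ t, w t * (φ t - m * η t) = w t * φ t - m * (w t * η t) := fun t => by ring
    simp_rw [this] at hz
    rw [integral_sub e1 (e2.const_mul m), integral_const_mul] at hz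
    linarith
  simp_rw [sub_mul]
  rw [integral_sub e1 e3, hwφ, setIntegral_Ioo_eq_integral_of_tsupport h3 (fun _ => C),
    integral_mul_const]
  ring

/-- Integration by parts for absolutely continuous functions; the boundary terms vanish with `φ`. -/
theorem setIntegral_primitive_mul_deriv {a b : ℝ} (hab : a < b) {v φ : ℝ → ℝ} (C : ℝ)
    (hv : IntegrableOn v (Ioo a b)) (h1 : ContDiff ℝ ∞ φ) (h3 : tsupport φ ⊆ Ioo a b) :
    ∫ t in Ioo a b, (C + ∫ s in a..t, v s) * deriv φ t = -∫ t in Ioo a b, v t * φ t := by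
  have hvi : IntervalIntegrable v volume a b := by
    rwa [intervalIntegrable_iff_integrableOn_Ioo_of_le hab.le]
  have hU : AbsolutelyContinuousOnInterval (fun t => C + ∫ s in a..t, v s) a b :=
    (LipschitzOnWith.absolutelyContinuousOnInterval (K := 0)
      (LipschitzWith.const C).lipschitzOnWith).add
      (hvi.absolutelyContinuousOnInterval_intervalIntegral left_mem_uIcc)
  have hφ : AbsolutelyContinuousOnInterval φ a b := by
    obtain ⟨K, hK⟩ := (h1.of_le (by simp) : ContDiff ℝ 1 φ).contDiffOn.exists_lipschitzOnWith
      one_ne_zero (convex_Icc a b) isCompact_Icc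
    rw [← uIcc_of_le hab.le] at hK
    exact hK.absolutelyContinuousOnInterval
  have ha : φ a = 0 := image_eq_zero_of_notMem_tsupport fun h => lt_irrefl _ (h3 h).1
  have hb : φ b = 0 := image_eq_zero_of_notMem_tsupport fun h => lt_irrefl _ (h3 h).2
  have key := hU.integral_mul_deriv_eq_deriv_mul hφ
  rw [ha, hb, mul_zero, mul_zero, sub_zero, zero_sub, intervalIntegral.integral_of_le hab.le,
    intervalIntegral.integral_of_le hab.le, integral_Ioc_eq_integral_Ioo,
    integral_Ioc_eq_integral_Ioo] at key
  rw [key]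
  congr 1
  refine setIntegral_congr_ae measurableSet_Ioo ?_
  filter_upwards [hvi.ae_hasDerivAt_integral] with t ht hmem
  have hmem' : t ∈ uIcc a b := by
    rw [uIcc_of_le hab.le]
    exact Ioo_subset_Icc_self hmem
  rw [((ht hmem' a left_mem_uIcc).const_add C).deriv]

theorem integrableOn_of_memLp_two {a b : ℝ} {v : ℝ → ℝ}
    (hv : MemLp v 2 (volume.restrict (Ioo a b))) : IntegrableOn v (Ioo a b) :=
  hv.integrable (by norm_num)

theorem MemH1.weakDeriv_memLp {a b : ℝ} {u : ℝ → ℝ} (h : MemH1 a b u) :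
    MemLp (weakDeriv a b u) 2 (volume.restrict (Ioo a b)) := by
  rw [weakDeriv, dif_pos h]
  exact h.2.choose_spec.1

theorem MemH1.isWeakDeriv {a b : ℝ} {u : ℝ → ℝ} (h : MemH1 a b u) :
    IsWeakDeriv a b u (weakDeriv a b u) := by
  rw [weakDeriv, dif_pos h]
  exact h.2.choose_spec.2

theorem eqOn_Icc_of_ae_eq {a b : ℝ} (hab : a < b) {u v : ℝ → ℝ} (hu : ContinuousOn u (Icc a b))
    (hv : ContinuousOn v (Icc a b)) (h : ∀ᵐ t, t ∈ Ioo a b → u t = v t) :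
    EqOn u v (Icc a b) := by
  have h1 : EqOn u v (Ioo a b) :=
    Measure.eqOn_open_of_ae_eq ((ae_restrict_iff' measurableSet_Ioo).2 h) isOpen_Ioo
      (hu.mono Ioo_subset_Icc_self) (hv.mono Ioo_subset_Icc_self)
  exact h1.of_subset_closure hu hv Ioo_subset_Icc_self (closure_Ioo hab.ne).ge

theorem continuousOn_primitive {a b : ℝ} (hab : a < b) {v : ℝ → ℝ}
    (hv : IntegrableOn v (Ioo a b)) : ContinuousOn (fun t => ∫ s in a..t, v s) (Icc a b) := by
  have hvi : IntervalIntegrable v volume a b := by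
    rwa [intervalIntegrable_iff_integrableOn_Ioo_of_le hab.le]
  rw [← uIcc_of_le hab.le]
  exact intervalIntegral.continuousOn_primitive_interval' hvi left_mem_uIcc

/-- The difference of `u` and the primitive of its weak derivative has weak derivative zero. It is
constant almost everywhere by du Bois-Reymond, hence everywhere by continuity. -/
theorem MemH1.eq_add_integral_weakDeriv {a b : ℝ} (hab : a < b) {u : ℝ → ℝ} (h : MemH1 a b u)
    (hu : ContinuousOn u (Icc a b)) :
    ∀ t ∈ Icc a b, u t = u a + ∫ s in a..t, weakDeriv a b u s := by
  have hv := integrableOn_of_memLp_two h.weakDeriv_memLp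
  have hcont := continuousOn_primitive hab hv
  have hw : IntegrableOn (fun t => u t - ∫ s in a..t, weakDeriv a b u s) (Ioo a b) :=
    ((hu.sub hcont).integrableOn_Icc).mono_set Ioo_subset_Icc_self
  obtain ⟨C, hC⟩ := ae_eq_const_of_forall_setIntegral_mul_deriv_eq_zero hab hw (by
    intro φ h1 h2 h3
    have hd1 : Continuous (deriv φ) := h1.continuous_deriv (by simp)
    have e1 := h.isWeakDeriv φ h1 h2 h3
    have e2 := setIntegral_primitive_mul_deriv hab 0 hv h1 h3
    simp_rw [zero_add] at e2
    simp_rw [sub_mul]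
    rw [integral_sub, e1, e2, sub_self]
    · exact integrableOn_mul_of_continuous (hu.integrableOn_Icc.mono_set Ioo_subset_Icc_self)
        hd1 h2.deriv
    · exact integrableOn_mul_of_continuous (hcont.integrableOn_Icc.mono_set Ioo_subset_Icc_self)
        hd1 h2.deriv)
  have heq := eqOn_Icc_of_ae_eq hab (hu.sub hcont) continuousOn_const hC
  have ha : u a - ∫ s in a..a, weakDeriv a b u s = C := heq (left_mem_Icc.2 hab.le)
  rw [intervalIntegral.integral_same, sub_zero] at ha
  intro t ht
  have : u t - ∫ s in a..t, weakDeriv a b u s = C := heq ht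
  linarith

/-- The converse passage, used to recognise the solution formula as an `H¹` function. The last
clause identifies the chosen representative `weakDeriv` up to a null set. -/
theorem memH1_of_eq_add_integral {a b C : ℝ} (hab : a < b) {u v : ℝ → ℝ}
    (hv : MemLp v 2 (volume.restrict (Ioo a b)))
    (hu : ∀ t ∈ Icc a b, u t = C + ∫ s in a..t, v s) :
    MemH1 a b u ∧ ContinuousOn u (Icc a b) ∧
      ∀ᵐ t, t ∈ Ioo a b → weakDeriv a b u t = v t := by
  have hvi := integrableOn_of_memLp_two hv
  have hcont : ContinuousOn u (Icc a b) :=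
    (continuousOn_const.add (continuousOn_primitive hab hvi)).congr hu
  have hweak : IsWeakDeriv a b u v := by
    intro φ h1 _ h3
    rw [← setIntegral_primitive_mul_deriv hab C hvi h1 h3]
    exact setIntegral_congr_fun measurableSet_Ioo fun t ht => by
      simp only [hu t (Ioo_subset_Icc_self ht)]
  have hH1 : MemH1 a b u := by
    refine ⟨?_, v, hv, hweak⟩
    obtain ⟨M, hM⟩ := isCompact_Icc.exists_bound_of_continuousOn hcont
    refine MemLp.of_bound ((hcont.mono Ioo_subset_Icc_self).aestronglyMeasurable
      measurableSet_Ioo) M ?_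
    filter_upwards [ae_restrict_mem measurableSet_Ioo] with t ht
    exact hM t (Ioo_subset_Icc_self ht)
  refine ⟨hH1, hcont, ?_⟩
  have hwi := integrableOn_of_memLp_two hH1.weakDeriv_memLp
  have := ae_eq_zero_of_forall_setIntegral_mul_eq_zero
    (w := fun t => weakDeriv a b u t - v t) (hwi.sub hvi) (by
      intro φ h1 h2 h3
      simp_rw [sub_mul]
      rw [integral_sub (integrableOn_mul_of_continuous hwi h1.continuous h2)
        (integrableOn_mul_of_continuous hvi h1.continuous h2)]
      linarith [hH1.isWeakDeriv φ h1 h2 h3, hweak φ h1 h2 h3])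
  filter_upwards [this] with t ht hmem
  exact sub_eq_zero.1 (ht hmem)

/-! ### Algebra of one-sided convolution -/

theorem conv_one (q : ℝ → ℝ) (t : ℝ) : conv (fun _ => 1) q t = ∫ s in (0 : ℝ)..t, q s := by
  simp [conv]

theorem conv_const_mul_left (c : ℝ) (p q : ℝ → ℝ) (t : ℝ) :
    conv (fun s => c * p s) q t = c * conv p q t := by
  rw [conv, conv, ← intervalIntegral.integral_const_mul]
  exact intervalIntegral.integral_congr fun s _ => mul_assoc _ _ _

theorem conv_const_mul_right (c : ℝ) (p q : ℝ → ℝ) (t : ℝ) :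
    conv p (fun s => c * q s) t = c * conv p q t := by
  rw [conv_comm, conv_const_mul_left, conv_comm]

section Continuous

variable {T t : ℝ}

theorem intervalIntegrable_conv_integrand_of_continuous {p q : ℝ → ℝ} (hp : Continuous p)
    (hq : IntegrableOn q (Ioc 0 T)) (ht : t ∈ Icc 0 T) :
    IntervalIntegrable (fun s => p (t - s) * q s) volume 0 t := by
  obtain ⟨M, hM⟩ := isCompact_Icc.exists_bound_of_continuousOn (s := Icc 0 T) hp.continuousOn
  exact intervalIntegrable_conv_integrand (hp.integrableOn_Icc.mono_set Ioc_subset_Icc_self)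
    (fun s hs => hM s (Ioc_subset_Icc_self hs)) hq ht

theorem conv_add_left {p p' q : ℝ → ℝ} (hp : Continuous p) (hp' : Continuous p')
    (hq : IntegrableOn q (Ioc 0 T)) (ht : t ∈ Icc 0 T) :
    conv (fun s => p s + p' s) q t = conv p q t + conv p' q t := by
  rw [conv, conv, conv, ← intervalIntegral.integral_add
    (intervalIntegrable_conv_integrand_of_continuous hp hq ht)
    (intervalIntegrable_conv_integrand_of_continuous hp' hq ht)]
  exact intervalIntegral.integral_congr fun s _ => add_mul _ _ _

theorem conv_add_right {p q q' : ℝ → ℝ} (hp : Continuous p)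
    (hq : IntegrableOn q (Ioc 0 T)) (hq' : IntegrableOn q' (Ioc 0 T)) (ht : t ∈ Icc 0 T) :
    conv p (fun s => q s + q' s) t = conv p q t + conv p q' t := by
  rw [conv, conv, conv, ← intervalIntegral.integral_add
    (intervalIntegrable_conv_integrand_of_continuous hp hq ht)
    (intervalIntegrable_conv_integrand_of_continuous hp hq' ht)]
  exact intervalIntegral.integral_congr fun s _ => mul_add _ _ _

theorem conv_assoc_of_continuous {p q r : ℝ → ℝ} (hp : Continuous p)
    (hq : IntegrableOn q (Ioc 0 T)) (hr : IntegrableOn r (Ioc 0 T)) (ht : t ∈ Icc 0 T) :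
    conv (conv p q) r t = conv p (conv q r) t := by
  obtain ⟨M, hM⟩ := isCompact_Icc.exists_bound_of_continuousOn (s := Icc 0 T) hp.continuousOn
  exact conv_assoc (hp.integrableOn_Icc.mono_set Ioc_subset_Icc_self)
    (fun s hs => hM s (Ioc_subset_Icc_self hs)) hq hr ht

theorem conv_congr_left {p p' : ℝ → ℝ} (q : ℝ → ℝ) (ht : t ∈ Icc 0 T)
    (h : ∀ s ∈ Ioc 0 T, p s = p' s) : conv p q t = conv p' q t :=
  conv_congr ht h (.of_forall fun _ _ => rfl)

theorem conv_congr_right (p : ℝ → ℝ) {q q' : ℝ → ℝ} (ht : t ∈ Icc 0 T)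
    (h : ∀ s ∈ Ioc 0 T, q s = q' s) : conv p q t = conv p q' t :=
  conv_congr ht (fun _ _ => rfl) (.of_forall fun s hs => h s (Ioo_subset_Ioc_self hs))

end Continuous

/-! ### The Volterra equation and its resolvent -/

section MittagLeffler

variable {α : ℝ} {T t : ℝ}

theorem integrableOn_mlKernel (hα : 0 < α) (c : ℝ) (hT : 0 ≤ T) :
    IntegrableOn (mlKernel α α c) (Ioc 0 T) :=
  (intervalIntegrable_iff_integrableOn_Ioc_of_le hT).1 (intervalIntegrable_mlKernel hα hα c 0 T)

theorem rlKernel_one : rlKernel 1 = fun _ => 1 := by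
  ext t
  simp [rlKernel]

theorem conv_one_mlKernel (hα : 0 < α) (c : ℝ) (ht : 0 < t) :
    conv (fun _ => 1) (mlKernel α α c) t = mlKernel α (1 + α) c t := by
  rw [← rlKernel_one, conv_rlKernel_mlKernel hα hα one_pos c ht, add_comm]

/-- Associativity moves the integration onto the kernel. Taking `κ = c` produces `mlKernel α 1 c`;
taking `κ = c + α / (1 - α)` with `c = ω` produces `g`. -/
theorem conv_one_add_const_mul_conv_mlKernel (hα : 0 < α) (c κ : ℝ) {q : ℝ → ℝ}
    (hq : IntegrableOn q (Ioc 0 T)) (ht : t ∈ Icc 0 T) :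
    conv (fun _ => 1) (fun s => q s + κ * conv (mlKernel α α c) q s) t =
      conv (fun s => 1 + κ * mlKernel α (1 + α) c s) q t := by
  have hT : 0 ≤ T := ht.1.trans ht.2
  have he := integrableOn_mlKernel hα c hT
  have hc := continuous_mlKernel (β := 1 + α) hα (by linarith) c
  rw [conv_add_right continuous_const hq ((integrableOn_conv he hq).const_mul κ) ht,
    conv_const_mul_right, ← conv_assoc_of_continuous continuous_const he hq ht,
    conv_congr_left q ht (fun s hs => conv_one_mlKernel hα c hs.1),
    conv_add_left continuous_const (hc.const_mul κ) hq ht, conv_const_mul_left]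

/-- A resolvent identity, the partial fraction decomposition of `s^(α-1)/((s^α - c)(s^α - d))`.
Expanding either the right or the left factor by its recursion gives two expressions for the same
convolution; combining them with weights `c` and `-d` eliminates the mixed term. -/
theorem sub_mul_conv_mlKernel (hα : 0 < α) (c d : ℝ) (ht : 0 < t) :
    (c - d) * conv (mlKernel α 1 c) (mlKernel α α d) t =
      mlKernel α 1 c t - mlKernel α 1 d t := by
  have htt : t ∈ Icc 0 t := ⟨ht.le, le_rfl⟩
  have hP := continuous_mlKernel (β := 1) hα le_rfl c
  have hQ := continuous_mlKernel (β := 1 + α) hα (by linarith) c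
  have he := integrableOn_mlKernel hα d ht.le
  have hr : IntegrableOn (rlKernel α) (Ioc 0 t) :=
    (intervalIntegrable_iff_integrableOn_Ioc_of_le ht.le).1 (intervalIntegrable_rlKernel hα 0 t)
  have hPr : ∀ s ∈ Ioc 0 t, conv (mlKernel α 1 c) (rlKernel α) s = mlKernel α (1 + α) c s :=
    fun s hs => by rw [conv_comm, conv_rlKernel_mlKernel hα one_pos hα c hs.1]
  have h1 : conv (mlKernel α 1 c) (mlKernel α α d) t =
      mlKernel α (1 + α) c t + d * conv (mlKernel α (1 + α) c) (mlKernel α α d) t := by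
    rw [conv_congr_right (q' := fun s => rlKernel α s +
        d * conv (rlKernel α) (mlKernel α α d) s) _ htt fun s hs => by
          rw [mlKernel_eq_add hα hα d hs.1, conv_rlKernel_mlKernel hα hα hα d hs.1],
      conv_add_right hP hr ((integrableOn_conv hr he).const_mul d) htt, conv_const_mul_right,
      ← conv_assoc_of_continuous hP hr he htt, conv_congr_left _ htt hPr, hPr t ⟨ht, le_rfl⟩]
  have h2 : conv (mlKernel α 1 c) (mlKernel α α d) t =
      mlKernel α (1 + α) d t + c * conv (mlKernel α (1 + α) c) (mlKernel α α d) t := by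
    rw [conv_congr_left (p' := fun s => 1 + c * mlKernel α (1 + α) c s) _ htt
        fun s hs => mlKernel_one_eq_add hα c hs.1.le,
      conv_add_left continuous_const (hQ.const_mul c) he htt, conv_const_mul_left,
      conv_one_mlKernel hα d ht]
  have h3 := mlKernel_one_eq_add hα c ht.le
  have h4 := mlKernel_one_eq_add hα d ht.le
  rw [h3, h4]
  linear_combination c * h1 - d * h2

/-- The kernel of the integral equation for `u'`. -/
def volterraKernel (α N lam s : ℝ) : ℝ :=
  N / (1 - α) * mlKernel α 1 (-(α / (1 - α))) s + -lam

theorem continuous_volterraKernel (hα : 0 < α) (N lam : ℝ) :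
    Continuous (volterraKernel α N lam) :=
  (continuous_const.mul (continuous_mlKernel hα le_rfl _)).add continuous_const

theorem conv_volterraKernel (hα : 0 < α) (N lam : ℝ) {q : ℝ → ℝ}
    (hq : IntegrableOn q (Ioc 0 T)) (ht : t ∈ Icc 0 T) :
    conv (volterraKernel α N lam) q t =
      N / (1 - α) * conv (mlKernel α 1 (-(α / (1 - α)))) q t - lam * ∫ s in (0 : ℝ)..t, q s := by
  unfold volterraKernel
  rw [conv_add_left ((continuous_mlKernel hα le_rfl _).const_mul _) continuous_const
    hq ht, conv_const_mul_left,
    show conv (fun _ => -lam) q t = -(lam * ∫ s in (0 : ℝ)..t, q s) by simp [conv],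
    ← sub_eq_add_neg]

theorem mul_conv_volterraKernel_mlKernel {N lam θ : ℝ} (hα : 0 < α)
    (hθ : (N / (1 - α) - lam) * θ = lam * (α / (1 - α))) (ht : 0 < t) :
    (θ + α / (1 - α)) * conv (volterraKernel α N lam) (mlKernel α α θ) t =
      (N / (1 - α) - lam) - volterraKernel α N lam t := by
  rw [conv_volterraKernel hα N lam (integrableOn_mlKernel hα θ ht.le) ⟨ht.le, le_rfl⟩,
    ← conv_one, conv_one_mlKernel hα θ ht, volterraKernel]
  have h1 := sub_mul_conv_mlKernel hα (-(α / (1 - α))) θ ht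
  have h2 := mlKernel_one_eq_add hα θ ht.le
  linear_combination (-(N / (1 - α))) * h1 + N / (1 - α) * h2 + mlKernel α (1 + α) θ t * hθ

theorem conv_volterraKernel_resolvent {N lam θ : ℝ} (hα : 0 < α)
    (hθ : (N / (1 - α) - lam) * θ = lam * (α / (1 - α))) {q : ℝ → ℝ}
    (hq : IntegrableOn q (Ioc 0 T)) (ht : t ∈ Icc 0 T) :
    conv (volterraKernel α N lam)
        (fun s => q s + (θ + α / (1 - α)) * conv (mlKernel α α θ) q s) t =
      (N / (1 - α) - lam) * ∫ s in (0 : ℝ)..t, q s := by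
  have hT : 0 ≤ T := ht.1.trans ht.2
  have he := integrableOn_mlKernel hα θ hT
  have hK := continuous_volterraKernel hα N lam
  rw [conv_add_right hK hq ((integrableOn_conv he hq).const_mul _) ht,
    conv_const_mul_right, ← conv_assoc_of_continuous hK he hq ht, ← conv_const_mul_left,
    conv_congr_left
      (p := fun s => (θ + α / (1 - α)) * conv (volterraKernel α N lam) (mlKernel α α θ) s)
      (p' := fun s => (N / (1 - α) - lam) * 1 + (-1) * volterraKernel α N lam s)
      q ht fun s hs => by rw [mul_conv_volterraKernel_mlKernel hα hθ hs.1]; ring,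
    conv_add_left continuous_const (hK.const_mul (-1)) hq ht, conv_const_mul_left,
    conv_const_mul_left, conv_one]
  ring

/-- Convolving both sides of the Volterra equation with the resolvent isolates the primitive of `v`.
This gives uniqueness without differentiating. -/
theorem mul_integral_eq_conv_of_volterra {N lam θ : ℝ} (hα : 0 < α)
    (hθ : (N / (1 - α) - lam) * θ = lam * (α / (1 - α))) {q v : ℝ → ℝ}
    (hq : IntegrableOn q (Ioc 0 T)) (hv : IntegrableOn v (Ioc 0 T))
    (h : ∀ s ∈ Ioc 0 T, conv (volterraKernel α N lam) v s = ∫ r in (0 : ℝ)..s, q r)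
    (ht : t ∈ Icc 0 T) :
    (N / (1 - α) - lam) * ∫ s in (0 : ℝ)..t, v s =
      conv (fun s => 1 + (θ + α / (1 - α)) * mlKernel α (1 + α) θ s) q t := by
  rcases ht.1.eq_or_lt with rfl | ht0
  · simp [conv]
  have he := integrableOn_mlKernel hα θ (ht.1.trans ht.2)
  have hK := continuous_volterraKernel hα N lam
  have h' : ∀ s ∈ Ioc 0 T, conv (volterraKernel α N lam) v s = conv (fun _ => 1) q s :=
    fun s hs => by rw [h s hs, conv_one]
  rw [← conv_volterraKernel_resolvent hα hθ hv ht,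
    ← conv_one_add_const_mul_conv_mlKernel hα θ _ hq ht,
    conv_add_right hK hv ((integrableOn_conv he hv).const_mul _) ht,
    conv_add_right continuous_const hq ((integrableOn_conv he hq).const_mul _) ht,
    conv_const_mul_right, conv_const_mul_right, h' t ⟨ht0, ht.2⟩]
  -- The remaining terms agree by commuting `e` to the right, so that `K * v` can be replaced by `1
  -- * q`, and commuting back.
  congr 2
  rw [conv_congr_right _ ht (fun s _ => conv_comm (mlKernel α α θ) v s),
    ← conv_assoc_of_continuous hK hv he ht, conv_congr_left _ ht h',
    conv_assoc_of_continuous continuous_const hq he ht,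
    conv_congr_right _ ht (fun s _ => conv_comm q (mlKernel α α θ) s)]

end MittagLeffler

/-! ### Solving the initial value problem -/

section InitialValueProblem

variable {B : ℝ → ℝ} {α b lam u₀ : ℝ} {f u : ℝ → ℝ}

theorem abcDeriv_eq (B : ℝ → ℝ) (α b : ℝ) (u : ℝ → ℝ) (t : ℝ) :
    abcDeriv B α 0 b u t =
      B α / (1 - α) * conv (mlKernel α 1 (-(α / (1 - α)))) (weakDeriv 0 b u) t := by
  simp only [abcDeriv, conv, mlKernel_one]

theorem omega_spec (hα1 : α < 1) (hlam : B α - lam * (1 - α) ≠ 0) :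
    (B α / (1 - α) - lam) * omega B α lam = lam * (α / (1 - α)) := by
  have : (1 - α) ≠ 0 := by linarith
  have hD : B α / (1 - α) - lam = (B α - lam * (1 - α)) / (1 - α) := by field_simp
  rw [omega, hD, div_mul_div_comm, mul_comm (1 - α), mul_div_mul_left _ _ hlam, mul_div_assoc]

theorem gKernel_eq (hα0 : 0 < α) {t : ℝ} (ht : 0 ≤ t) :
    gKernel B α lam t =
      1 + (omega B α lam + α / (1 - α)) * mlKernel α (1 + α) (omega B α lam) t := by
  have h : conv (fun s => s ^ (α - 1) / Real.Gamma α)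
      (fun s => mittagLeffler α (omega B α lam * s ^ α)) t =
      mlKernel α (1 + α) (omega B α lam) t := by
    simp_rw [← mlKernel_one]
    rcases ht.eq_or_lt with rfl | ht
    · simp [conv, mlKernel, hα0.ne']
    · exact conv_rlKernel_mlKernel hα0 one_pos hα0 _ ht
  rw [gKernel, h, ← mlKernel_one, mlKernel_one_eq_add hα0 _ ht]
  ring

/-- Compatibility turns `f 0` into `-λ u₀`, and `B(α) ω = (1 - α) λ (ω + α / (1 - α))` then cancels
the Mittag-Leffler parts of the terms in `E_α` and `f 0 * g`, leaving the constant `u₀`. -/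
theorem solutionFormula_eq (hα0 : 0 < α) (hα1 : α < 1) (hlam : B α - lam * (1 - α) ≠ 0)
    (h0 : lam * u₀ + f 0 = 0) {t : ℝ} (ht : t ∈ Icc 0 b) :
    solutionFormula B α b lam u₀ f t = u₀ + (B α / (1 - α) - lam)⁻¹ *
      conv (fun s => 1 + (omega B α lam + α / (1 - α)) * mlKernel α (1 + α) (omega B α lam) s)
        (weakDeriv 0 b f) t := by
  have h1 : (1 - α) ≠ 0 := by linarith
  have hθ := omega_spec hα1 hlam
  have hD : B α / (1 - α) - lam = (B α - lam * (1 - α)) / (1 - α) := by field_simp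
  have hθ' : B α * omega B α lam = (1 - α) * lam * (omega B α lam + α / (1 - α)) := by
    field_simp at hθ ⊢
    linear_combination hθ
  rw [solutionFormula, ← mlKernel_one, mlKernel_one_eq_add hα0 _ ht.1, gKernel_eq hα0 ht.1,
    conv_congr_left _ ht (fun s hs => gKernel_eq (B := B) (lam := lam) hα0 hs.1.le), hD, inv_div]
  generalize conv _ _ t = c
  have hf : f 0 = -(lam * u₀) := by linarith
  rw [hf, one_div, inv_mul_eq_iff_eq_mul₀ hlam]
  have h2 : (B α - lam * (1 - α)) * ((1 - α) / (B α - lam * (1 - α)) * c) = (1 - α) * c := by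
    field_simp
  rw [mul_add (B α - lam * (1 - α)), h2]
  linear_combination u₀ * mlKernel α (1 + α) (omega B α lam) t * hθ'

theorem integrableOn_Ioc_weakDeriv (h : MemH1 0 b u) :
    IntegrableOn (weakDeriv 0 b u) (Ioc 0 b) :=
  (integrableOn_Ioc_iff_integrableOn_Ioo (by finiteness)).2 (integrableOn_of_memLp_two h.weakDeriv_memLp)

/-- The right-hand side of the equation vanishes at the initial time, since the fractional
derivative does. -/
theorem IsSolution.compatibility (hα0 : 0 < α) (hb : 0 < b) (hfc : ContinuousOn f (Icc 0 b))
    (hu : IsSolution B α b lam u₀ f u) : lam * u₀ + f 0 = 0 := by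
  have hv := integrableOn_Ioc_weakDeriv hu.memH1
  set μ := -(α / (1 - α)) with hμ
  -- Since `P_μ = 1 + μ (1 * e_μ)`, the fractional derivative is a multiple of the primitive of this
  -- integrable `w`, hence continuous up to `0`.
  set w := fun s => weakDeriv 0 b u s + μ * conv (mlKernel α α μ) (weakDeriv 0 b u) s with hw
  have hwi : IntegrableOn w (Ioo 0 b) := (integrableOn_Ioc_iff_integrableOn_Ioo (by finiteness)).1
    (hv.add ((integrableOn_conv (integrableOn_mlKernel hα0 μ hb.le) hv).const_mul μ))
  have hd : ∀ t ∈ Icc 0 b, abcDeriv B α 0 b u t =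
      B α / (1 - α) * ∫ s in (0 : ℝ)..t, w s := by
    intro t ht
    rw [abcDeriv_eq, ← conv_one, hw, conv_one_add_const_mul_conv_mlKernel hα0 μ μ hv ht,
      conv_congr_left _ ht fun s hs => mlKernel_one_eq_add hα0 μ hs.1.le]
  -- The equation is assumed only for `t > 0`; continuity of both sides carries it to `t = 0`.
  have heq : EqOn (fun t => B α / (1 - α) * ∫ s in (0 : ℝ)..t, w s)
      (fun t => lam * u t + f t) (Icc 0 b) := by
    refine eqOn_Icc_of_ae_eq hb (continuousOn_const.mul (continuousOn_primitive hb hwi))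
      ((continuousOn_const.mul hu.continuousOn).add hfc) (.of_forall fun t ht => ?_)
    rw [← hd t (Ioo_subset_Icc_self ht), hu.equation t (Ioo_subset_Ioc_self ht)]
  have := heq (left_mem_Icc.2 hb.le)
  simp only [intervalIntegral.integral_same, mul_zero, hu.initial] at this
  exact this.symm

theorem IsSolution.eqOn_solutionFormula (hα0 : 0 < α) (hα1 : α < 1) (hb : 0 < b)
    (hlam : B α - lam * (1 - α) ≠ 0) (hf : MemH1 0 b f) (hfc : ContinuousOn f (Icc 0 b))
    (hu : IsSolution B α b lam u₀ f u) :
    EqOn u (solutionFormula B α b lam u₀ f) (Icc 0 b) := by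
  have h0 := hu.compatibility hα0 hb hfc
  have h1 : (1 - α) ≠ 0 := by linarith
  have hD : B α / (1 - α) - lam ≠ 0 := by
    intro h
    apply hlam
    field_simp at h
    linarith
  have hfi := hf.eq_add_integral_weakDeriv hb hfc
  have hui := hu.memH1.eq_add_integral_weakDeriv hb hu.continuousOn
  have hv := integrableOn_Ioc_weakDeriv hu.memH1
  intro t ht
  -- Compatibility cancels the constants `λ u₀` and `f 0`, leaving `K * u' = 1 * f'`.
  have key := mul_integral_eq_conv_of_volterra hα0 (omega_spec hα1 hlam)
    (integrableOn_Ioc_weakDeriv hf) hv (fun s hs => by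
      have hs' := Ioc_subset_Icc_self hs
      have he := hu.equation s hs
      rw [abcDeriv_eq, hui s hs', hfi s hs', hu.initial] at he
      rw [conv_volterraKernel hα0 _ _ hv hs']
      linear_combination he + h0) ht
  rw [solutionFormula_eq hα0 hα1 hlam h0 ht, ← key, hui t ht, hu.initial,
    inv_mul_cancel_left₀ hD]

theorem isSolution_solutionFormula (hα0 : 0 < α) (hα1 : α < 1) (hb : 0 < b)
    (hlam : B α - lam * (1 - α) ≠ 0) (hf : MemH1 0 b f) (hfc : ContinuousOn f (Icc 0 b))
    (h0 : lam * u₀ + f 0 = 0) :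
    IsSolution B α b lam u₀ f (solutionFormula B α b lam u₀ f) := by
  have h1 : (1 - α) ≠ 0 := by linarith
  have hD : B α / (1 - α) - lam ≠ 0 := by
    intro h
    apply hlam
    field_simp at h
    linarith
  set θ := omega B α lam with hθ
  set D := B α / (1 - α) - lam with hDdef
  set q := weakDeriv 0 b f with hq
  have hqi : IntegrableOn q (Ioc 0 b) := integrableOn_Ioc_weakDeriv hf
  have he := integrableOn_mlKernel hα0 θ hb.le
  set w := fun s => q s + (θ + α / (1 - α)) * conv (mlKernel α α θ) q s with hw
  -- The kernel `mlKernel α α θ` is singular at `0` and only its integrability is available, so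
  -- Young's inequality is what keeps `w` in `L²`.
  have hwL : MemLp w 2 (volume.restrict (Ioo 0 b)) :=
    hf.weakDeriv_memLp.add ((memLp_two_conv he hf.weakDeriv_memLp).const_mul _)
  have hrep : ∀ t ∈ Icc 0 b, solutionFormula B α b lam u₀ f t =
      u₀ + ∫ s in (0 : ℝ)..t, D⁻¹ * w s := by
    intro t ht
    rw [solutionFormula_eq hα0 hα1 hlam h0 ht, intervalIntegral.integral_const_mul, ← conv_one,
      hw, conv_one_add_const_mul_conv_mlKernel hα0 θ _ hqi ht]
  obtain ⟨hH1, hcont, hae⟩ := memH1_of_eq_add_integral hb (hwL.const_mul D⁻¹) hrep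
  refine ⟨hH1, hcont, fun t ht => ?_, ?_⟩
  · have ht' := Ioc_subset_Icc_self ht
    have hv : IntegrableOn w (Ioc 0 b) :=
      (integrableOn_Ioc_iff_integrableOn_Ioo (by finiteness)).2 (integrableOn_of_memLp_two hwL)
    -- Evaluating `K * w` in two ways, by its definition and by the resolvent, gives the equation
    -- after division by `D`.
    have k1 := conv_volterraKernel hα0 (B α) lam hv ht'
    rw [conv_volterraKernel_resolvent hα0 (omega_spec hα1 hlam) hqi ht', ← hDdef] at k1
    rw [abcDeriv_eq, conv_congr ht' (fun _ _ => rfl) hae, conv_const_mul_right, hrep t ht',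
      intervalIntegral.integral_const_mul, hf.eq_add_integral_weakDeriv hb hfc t ht', ← hq]
    have k2 : D⁻¹ * D = 1 := inv_mul_cancel₀ hD
    linear_combination (-D⁻¹) * k1 - h0 + (∫ s in (0 : ℝ)..t, q s) * k2
  · rw [hrep 0 (left_mem_Icc.2 hb.le)]
    simp

end InitialValueProblem

end ABCaputo

end

theorem lemma3p4 (B : ℝ → ℝ) (hB : ∀ x ∈ Set.Icc (0 : ℝ) 1, 0 < B x) (hB0 : B 0 = 1)
    (hB1 : B 1 = 1) (α : ℝ) (hα0 : 0 < α) (hα1 : α < 1) (b : ℝ) (hb : 0 < b)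
    (lam u₀ : ℝ) (hlam : B α - lam * (1 - α) ≠ 0)
    (f : ℝ → ℝ) (hf : ABCaputo.MemH1 0 b f) (hfc : ContinuousOn f (Set.Icc 0 b)) :
    ((∃ u : ℝ → ℝ, ABCaputo.IsSolution B α b lam u₀ f u) ↔ lam * u₀ + f 0 = 0) ∧
      (lam * u₀ + f 0 = 0 →
        ABCaputo.IsSolution B α b lam u₀ f (ABCaputo.solutionFormula B α b lam u₀ f) ∧
        ∀ u : ℝ → ℝ, ABCaputo.IsSolution B α b lam u₀ f u →
          Set.EqOn u (ABCaputo.solutionFormula B α b lam u₀ f) (Set.Icc 0 b)) :=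
  ⟨⟨fun ⟨_, hu⟩ => hu.compatibility hα0 hb hfc,
      fun h0 => ⟨_, ABCaputo.isSolution_solutionFormula hα0 hα1 hb hlam hf hfc h0⟩⟩,
    fun h0 => ⟨ABCaputo.isSolution_solutionFormula hα0 hα1 hb hlam hf hfc h0,
      fun _ hu => hu.eqOn_solutionFormula hα0 hα1 hb hlam hf hfc⟩⟩
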